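/- Let $n\ge 9$ be an integer and let $\mathcal S(n)$ be the number of solutions of $$\frac1{x_1}+\dots+\frac1{x_n}=1$$ in $n$ distinct positive integers (counted as sets $\{x_1,\dots,x_n\}$) for which there is an odd prime $q$ such that every $x_i$ is of the form $2^{\alpha}q^{\beta}$ with integers $0\le\alpha\le 2$ and $\beta\ge 0$. For $i\in\{1,2\}$ and $d\ge 1$ put $N_i(d)=2a_2(d)+5a_5(d)+2a_{\widehat 2}(d)$, where $a_2,a_5,a_{\widehat 2}$ (which depend on $i$) are given by $(a_2(1),a_5(1),a_{\widehat 2}(1))=(1,0,0)$ if $i=1$ and $(0,1,0)$ if $i=2$, and, for $d\ge 2$, $$a_2(d)=a_2(d-1)+3a_5(d-1)+a_{\widehat 2}(d-1),$$ $$a_{\widehat 2}(d)=a_5(d-1)+a_{\widehat 2}(d-1),$$ $$a_5(d)=a_2(d-1)+2a_5(d-1)+a_{\widehat 2}(d-1).$$ Let $c_n=1$ if $n$ is even and $c_n=2$ if $n$ is odd. Then $\mathcal S(n)$ is finite, $$\mathcal S(n)-c_n\le N_1(n-3)+N_2(n-3),$$ and $$N_1\Big(\frac n5\Big)+N_2\Big(\frac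 n5\Big)\le\mathcal S(n)-c_n\quad\text{if } n\equiv 0\pmod 5,$$ $$N_1\Big(\frac{n+4}5\Big)+N_2\Big(\frac{n-1}5\Big)\le\mathcal S(n)-c_n\quad\text{if } n\equiv 1\pmod 5,$$ $$N_1\Big(\frac{n+3}5\Big)+N_2\Big(\frac{n+3}5\Big)\le\mathcal S(n)-c_n\quad\text{if } n\equiv 2\pmod 5,$$ $$N_1\Big(\frac{n+2}5\Big)+N_2\Big(\frac{n-3}5\Big)\le\mathcal S(n)-c_n\quad\text{if } n\equiv 3\pmod 5,$$ $$N_1\Big(\frac{n+6}5\Big)+N_2\Big(\frac{n+1}5\Big)\le\mathcal S(n)-c_n\quad\text{if } n\equiv 4\pmod 5.$$ -/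

import Mathlib

namespace UnitFractions

/-- The solutions of `1 / x₁ + ⋯ + 1 / xₙ = 1` in `n` distinct positive integers, as `n`-element
sets, such that for one odd prime `q` every `xᵢ` has the form `2 ^ α * q ^ β` with `α ≤ 2`. -/
def solutions (n : ℕ) : Set (Finset ℕ) :=
  {X | X.card = n ∧ ∑ x ∈ X, (1 : ℚ) / (x : ℚ) = 1 ∧
    ∃ q : ℕ, q.Prime ∧ Odd q ∧ ∀ x ∈ X, ∃ α β : ℕ, α ≤ 2 ∧ x = 2 ^ α * q ^ β}

/-- The number of those solutions. -/
noncomputable def numSolutions (n : ℕ) : ℕ := (solutions n).ncard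

/-- The triple `(a₂(d), a₅(d), â₂(d))` for the tree number `i` (`i = 1` or `i = 2`), given by the
linear recurrences from depth `d = 1` on; at depth `0` there is no edge, and the value is `0`. -/
def counts (i : ℕ) : ℕ → ℕ × ℕ × ℕ
  | 0 => (0, 0, 0)
  | 1 => (if i = 1 then 1 else 0, if i = 2 then 1 else 0, 0)
  | d + 2 =>
    let a2 := (counts i (d + 1)).1
    let a5 := (counts i (d + 1)).2.1
    let ah := (counts i (d + 1)).2.2
    (a2 + 3 * a5 + ah, a2 + 2 * a5 + ah, a5 + ah)

/-- `N i d = 2 a₂(d) + 5 a₅(d) + 2 â₂(d)`, the node count `Nᵢ(d)`. -/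
def N (i d : ℕ) : ℕ :=
  2 * (counts i d).1 + 5 * (counts i d).2.1 + 2 * (counts i d).2.2

/-- `1` if `n` is even and `2` if `n` is odd. -/
def correction (n : ℕ) : ℕ := if Even n then 1 else 2

end UnitFractions

namespace UnitFractions

/-! Multiply the equation by 4 and sort a solution by powers of `q`. The elements prime to `q` form
a subset of `{1, 2, 4}`, whose sum of `4 / x` is a digit in `0, …, 7`; dividing the others by `q`
leaves a smaller problem with target `q * (t - digit)` (`encard_levelSets`). Targets are nonnegative
and, by a geometric series, below `7q / (q - 1)`, so few multiples of `q` survive: 3, 6, 9 for `q =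
3`; only `q` itself for `q = 5, 7`; none for `q ≥ 11`; target 0 leaves only the empty set.

Hence 5 gives one solution, 7 gives one exactly when `n` is odd, and together they make up
`correction n`. What remains is the count for `q = 3`, a linear recurrence. The bounds follow by
comparing growth: that count at most triples when `n` grows by 1 and at least quintuples when `n`
grows by 5, while `N i` grows by a factor between 3 and 5 per unit of depth. -/

/-- The `m`-element sets of integers `2 ^ α * q ^ β` with `α ≤ 2` satisfying `∑ 4 / x = t`. -/
def levelSets (q : ℕ) (t m : ℤ) : Set (Finset ℕ) :=
  {X | (X.card : ℤ) = m ∧ ∑ x ∈ X, (4 : ℚ) / (x : ℚ) = t ∧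
    ∀ x ∈ X, ∃ α β : ℕ, α ≤ 2 ∧ x = 2 ^ α * q ^ β}

/-- The sum of `4 / x` over a subset of `{1, 2, 4}`. -/
def digit (D : Finset ℕ) : ℤ := ∑ x ∈ D, 4 / (x : ℤ)

lemma cast_digit {D : Finset ℕ} (hD : D ⊆ {1, 2, 4}) :
    (digit D : ℚ) = ∑ x ∈ D, (4 : ℚ) / (x : ℚ) := by
  unfold digit
  push_cast
  refine Finset.sum_congr rfl fun x hx => ?_
  have := hD hx
  simp only [Finset.mem_insert, Finset.mem_singleton] at this
  rcases this with rfl | rfl | rfl <;> norm_num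

lemma not_dvd_of_mem {q d : ℕ} (hq : 3 ≤ q) (hodd : Odd q) (hd : d ∈ ({1, 2, 4} : Finset ℕ)) :
    ¬ q ∣ d := by
  intro h
  have hle : q ≤ 4 := by
    have := Nat.le_of_dvd (by simp at hd; omega) h
    simp at hd
    omega
  obtain rfl : q = 3 := by
    obtain ⟨k, hk⟩ := hodd
    omega
  simp at hd
  omega

/-! ### Peeling off the lowest level -/

/-- Multiply a set by `q` and adjoin a lowest level `D`. -/
def prepend (q : ℕ) (D Y : Finset ℕ) : Finset ℕ := D ∪ Y.image (q * ·)

lemma disjoint_prepend {q : ℕ} (hq : 3 ≤ q) (hodd : Odd q) {D : Finset ℕ} (hD : D ⊆ {1, 2, 4})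
    (Y : Finset ℕ) : Disjoint D (Y.image (q * ·)) := by
  rw [Finset.disjoint_left]
  intro d hd hd'
  obtain ⟨y, -, rfl⟩ := Finset.mem_image.1 hd'
  exact not_dvd_of_mem hq hodd (hD hd) (dvd_mul_right q y)

lemma injective_mul_left {q : ℕ} (hq : 3 ≤ q) : Function.Injective (q * · : ℕ → ℕ) :=
  fun _ _ h => Nat.eq_of_mul_eq_mul_left (by omega) h

lemma filter_prepend {q : ℕ} (hq : 3 ≤ q) (hodd : Odd q) {D : Finset ℕ} (hD : D ⊆ {1, 2, 4})
    (Y : Finset ℕ) : (prepend q D Y).filter (¬ q ∣ ·) = D := by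
  ext x
  simp only [prepend, Finset.mem_filter, Finset.mem_union, Finset.mem_image]
  constructor
  · rintro ⟨h | ⟨y, -, rfl⟩, h'⟩
    · exact h
    · exact absurd (dvd_mul_right q y) h'
  · exact fun h => ⟨Or.inl h, not_dvd_of_mem hq hodd (hD h)⟩

lemma prepend_injective {q : ℕ} (hq : 3 ≤ q) (hodd : Odd q) {D : Finset ℕ} (hD : D ⊆ {1, 2, 4}) :
    Function.Injective (prepend q D) := by
  intro Y Z h
  apply Finset.image_injective (injective_mul_left hq)
  have key := fun Y => Finset.union_sdiff_cancel_left (disjoint_prepend hq hodd hD Y)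
  rw [← key Y, ← key Z]
  exact congrArg (· \ D) h

lemma prepend_mem_levelSets {q : ℕ} (hq : 3 ≤ q) (hodd : Odd q) {D : Finset ℕ}
    (hD : D ⊆ {1, 2, 4}) (Y : Finset ℕ) (t m : ℤ) :
    prepend q D Y ∈ levelSets q t m ↔ Y ∈ levelSets q (q * (t - digit D)) (m - D.card) := by
  have hdis := disjoint_prepend hq hodd hD Y
  have hq0 : (q : ℚ) ≠ 0 := by positivity
  have hcard : (prepend q D Y).card = D.card + Y.card := by
    rw [prepend, Finset.card_union_of_disjoint hdis,
      Finset.card_image_of_injective _ (injective_mul_left hq)]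
  have hsum : ∑ x ∈ prepend q D Y, (4 : ℚ) / (x : ℚ)
      = digit D + (∑ y ∈ Y, (4 : ℚ) / (y : ℚ)) / q := by
    rw [prepend, Finset.sum_union hdis, cast_digit hD,
      Finset.sum_image (fun _ _ _ _ h => injective_mul_left hq h), Finset.sum_div]
    congr 1
    refine Finset.sum_congr rfl fun y _ => ?_
    push_cast
    rw [div_div, mul_comm]
  have hform : (∀ x ∈ prepend q D Y, ∃ α β : ℕ, α ≤ 2 ∧ x = 2 ^ α * q ^ β) ↔
      ∀ x ∈ Y, ∃ α β : ℕ, α ≤ 2 ∧ x = 2 ^ α * q ^ β := by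
    constructor
    · intro h y hy
      obtain ⟨α, β, hα, hx⟩ :=
        h (q * y) (Finset.mem_union_right _ (Finset.mem_image_of_mem _ hy))
      cases β with
      | zero =>
        -- With exponent 0 the multiple `q * y` would lie in `{1, 2, 4}`.
        refine absurd ⟨y, rfl⟩ (not_dvd_of_mem (d := q * y) hq hodd ?_)
        rw [hx]
        interval_cases α <;> simp
      | succ β =>
        refine ⟨α, β, hα, injective_mul_left hq ?_⟩
        simp only [hx]
        ring
    · intro h x hx
      rcases Finset.mem_union.1 hx with hx | hx
      · have := hD hx
        simp only [Finset.mem_insert, Finset.mem_singleton] at this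
        rcases this with rfl | rfl | rfl
        exacts [⟨0, 0, by simp⟩, ⟨1, 0, by simp⟩, ⟨2, 0, by simp⟩]
      · obtain ⟨y, hy, rfl⟩ := Finset.mem_image.1 hx
        obtain ⟨α, β, hα, rfl⟩ := h y hy
        exact ⟨α, β + 1, hα, by ring⟩
  simp only [levelSets, Set.mem_ofPred_eq, hcard, hsum, hform]
  refine and_congr ?_ (and_congr_left fun _ => ?_)
  · push_cast
    omega
  · push_cast
    rw [← eq_sub_iff_add_eq', div_eq_iff hq0, mul_comm]

lemma eq_prepend {q : ℕ} {t m : ℤ} {X : Finset ℕ} (hX : X ∈ levelSets q t m) :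
    X.filter (¬ q ∣ ·) ⊆ {1, 2, 4} ∧ ∃ Y, X = prepend q (X.filter (¬ q ∣ ·)) Y := by
  constructor
  · intro x hx
    rw [Finset.mem_filter] at hx
    obtain ⟨α, β, hα, rfl⟩ := hX.2.2 x hx.1
    cases β with
    | zero => interval_cases α <;> simp
    | succ β => exact absurd ⟨2 ^ α * q ^ β, by ring⟩ hx.2
  · refine ⟨(X.filter (q ∣ ·)).image (· / q), ?_⟩
    have : ((X.filter (q ∣ ·)).image (· / q)).image (q * ·) = X.filter (q ∣ ·) := by
      rw [Finset.image_image]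
      conv_rhs => rw [← Finset.image_id (s := X.filter (q ∣ ·))]
      refine Finset.image_congr fun x hx => ?_
      exact Nat.mul_div_cancel' (Finset.mem_filter.1 hx).2
    rw [prepend, this, Finset.union_comm, Finset.filter_union_filter_not_eq]

lemma levelSets_eq_iUnion {q : ℕ} (hq : 3 ≤ q) (hodd : Odd q) (t m : ℤ) :
    levelSets q t m = ⋃ D : {D // D ∈ ({1, 2, 4} : Finset ℕ).powerset},
      prepend q D '' levelSets q (q * (t - digit D)) (m - (D : Finset ℕ).card) := by
  ext X
  simp only [Set.mem_iUnion, Set.mem_image]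
  constructor
  · intro hX
    obtain ⟨hD, Y, hY⟩ := eq_prepend hX
    refine ⟨⟨_, Finset.mem_powerset.2 hD⟩, Y, ?_, hY.symm⟩
    rw [← prepend_mem_levelSets hq hodd hD, ← hY]
    exact hX
  · rintro ⟨⟨D, hD⟩, Y, hY, rfl⟩
    exact (prepend_mem_levelSets hq hodd (Finset.mem_powerset.1 hD) Y t m).2 hY

/-- The eight subsets of `{1, 2, 4}` realise each digit `0, …, 7` exactly once. Using `encard` lets
the recurrence hold before finiteness is known; finiteness then comes out of the count. -/
lemma encard_levelSets {q : ℕ} (hq : 3 ≤ q) (hodd : Odd q) (t m : ℤ) :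
    (levelSets q t m).encard =
      (levelSets q (q * t) m).encard + (levelSets q (q * (t - 1)) (m - 1)).encard
      + (levelSets q (q * (t - 2)) (m - 1)).encard + (levelSets q (q * (t - 4)) (m - 1)).encard
      + (levelSets q (q * (t - 3)) (m - 2)).encard + (levelSets q (q * (t - 5)) (m - 2)).encard
      + (levelSets q (q * (t - 6)) (m - 2)).encard
      + (levelSets q (q * (t - 7)) (m - 3)).encard := by
  rw [levelSets_eq_iUnion hq hodd, Set.encard_iUnion_of_finite, finsum_eq_sum_of_fintype]
  · have h : ∀ D : {D // D ∈ ({1, 2, 4} : Finset ℕ).powerset},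
        (prepend q D '' levelSets q (q * (t - digit D)) (m - (D : Finset ℕ).card)).encard
        = (levelSets q (q * (t - digit D)) (m - (D : Finset ℕ).card)).encard := fun D =>
      (prepend_injective hq hodd (Finset.mem_powerset.1 D.2)).encard_image _
    simp only [h]
    rw [Finset.sum_coe_sort _ (fun D : Finset ℕ =>
      (levelSets q (q * (t - digit D)) (m - D.card)).encard)]
    have hP : ({1, 2, 4} : Finset ℕ).powerset
        = {∅, {4}, {2}, {1}, {2, 4}, {1, 4}, {1, 2}, {1, 2, 4}} := by decide
    have d0 : digit ∅ = 0 := rfl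
    have d1 : digit {4} = 1 := rfl
    have d2 : digit {2} = 2 := rfl
    have d4 : digit {1} = 4 := rfl
    have d3 : digit {2, 4} = 3 := rfl
    have d5 : digit {1, 4} = 5 := rfl
    have d6 : digit {1, 2} = 6 := rfl
    have d7 : digit {1, 2, 4} = 7 := rfl
    rw [hP]
    repeat rw [Finset.sum_insert (by decide)]
    rw [Finset.sum_singleton, d0, d1, d2, d3, d4, d5, d6, d7]
    simp [add_assoc]
  · intro D E hDE
    refine Set.disjoint_left.2 ?_
    rintro _ ⟨Y, -, rfl⟩ ⟨Z, -, h⟩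
    apply hDE
    apply Subtype.ext
    rw [← filter_prepend hq hodd (Finset.mem_powerset.1 D.2) Y, ← h,
      filter_prepend hq hodd (Finset.mem_powerset.1 E.2)]

/-! ### Targets at which the recursion stops -/

lemma levelSets_eq_empty_of_card_neg {q : ℕ} {t m : ℤ} (hm : m < 0) : levelSets q t m = ∅ := by
  ext X
  simp only [levelSets, Set.mem_ofPred_eq, Set.mem_empty_iff_false, iff_false]
  rintro ⟨h, -⟩
  omega

lemma levelSets_eq_empty_of_neg {q : ℕ} {t m : ℤ} (ht : t < 0) : levelSets q t m = ∅ := by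
  ext X
  simp only [levelSets, Set.mem_ofPred_eq, Set.mem_empty_iff_false, iff_false]
  rintro ⟨-, h, -⟩
  have : (0 : ℚ) ≤ t := h ▸ Finset.sum_nonneg fun x _ => by positivity
  exact absurd ht (by exact_mod_cast not_lt.2 this)

lemma levelSets_zero {q : ℕ} (hq : 3 ≤ q) (m : ℤ) :
    levelSets q 0 m = if m = 0 then {∅} else ∅ := by
  have h : ∀ X, X ∈ levelSets q 0 m ↔ X = ∅ ∧ m = 0 := by
    intro X
    constructor
    · rintro ⟨h1, h2, h3⟩
      have : X = ∅ := by
        rw [Finset.eq_empty_iff_forall_notMem]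
        intro x hx
        rw [Int.cast_zero, Finset.sum_eq_zero_iff_of_nonneg (fun x _ => by positivity)] at h2
        obtain ⟨α, β, -, rfl⟩ := h3 x hx
        have := h2 _ hx
        have h0 : (((2 ^ α * q ^ β : ℕ)) : ℚ) ≠ 0 := by
          have : q ≠ 0 := by omega
          positivity
        rw [div_eq_zero_iff] at this
        simp_all
      subst this
      simpa [eq_comm] using h1
    · rintro ⟨rfl, rfl⟩
      simp [levelSets]
  ext X
  rw [h]
  split_ifs with hm <;> simp [hm]

lemma encard_levelSets_zero {q : ℕ} (hq : 3 ≤ q) (m : ℤ) :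
    (levelSets q 0 m).encard = if m = 0 then 1 else 0 := by
  rw [levelSets_zero hq]
  split_ifs <;> simp

/-- All admissible integers together contribute `7 * ∑ q⁻ᵇ = 7q / (q - 1)`. A finite set stays
strictly below this, so equality is excluded too. -/
lemma levelSets_eq_empty_of_le {q : ℕ} (hq : 3 ≤ q) {t m : ℤ} (ht : 7 * q ≤ (q - 1) * t) :
    levelSets q t m = ∅ := by
  rw [Set.eq_empty_iff_forall_notMem]
  rintro X ⟨-, hsum, hform⟩
  choose! α β hα hx using hform
  have hq1 : (1 : ℚ) < q := by exact_mod_cast (by omega : 1 < q)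
  obtain ⟨B, hB⟩ : ∃ B, ∀ x ∈ X, β x < B :=
    ⟨X.sup β + 1, fun x hx => Nat.lt_succ_of_le (Finset.le_sup hx)⟩
  have h1 : ∑ x ∈ X, (4 : ℚ) / (x : ℚ)
      ≤ ∑ p ∈ Finset.range 3 ×ˢ Finset.range B, (4 : ℚ) / (2 ^ p.1 * q ^ p.2) := by
    have himg : ∑ x ∈ X, (4 : ℚ) / (x : ℚ)
        = ∑ p ∈ X.image (fun x => (α x, β x)), (4 : ℚ) / (2 ^ p.1 * q ^ p.2) := by
      rw [Finset.sum_image]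
      · refine Finset.sum_congr rfl fun x h => ?_
        conv_lhs => rw [hx x h]
        push_cast
        rfl
      -- Only the recovery of `x` from its exponents is needed, not uniqueness of the exponents.
      · intro x h y h' hxy
        simp only [Prod.mk.injEq] at hxy
        rw [hx x h, hx y h', hxy.1, hxy.2]
    rw [himg]
    refine Finset.sum_le_sum_of_subset_of_nonneg ?_ fun p _ _ => by positivity
    intro p hp
    obtain ⟨x, h, rfl⟩ := Finset.mem_image.1 hp
    simp only [Finset.mem_product, Finset.mem_range]
    exact ⟨by have := hα x h; omega, hB x h⟩
  have h2 : ∑ p ∈ Finset.range 3 ×ˢ Finset.range B, (4 : ℚ) / (2 ^ p.1 * q ^ p.2)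
      = 7 * ∑ b ∈ Finset.range B, ((q : ℚ)⁻¹) ^ b := by
    rw [Finset.sum_product_right, Finset.mul_sum]
    refine Finset.sum_congr rfl fun b _ => ?_
    simp only [Finset.sum_range_succ, Finset.sum_range_zero, inv_pow]
    have : (q : ℚ) ≠ 0 := by positivity
    field_simp
    norm_num
  have h3 : ((q : ℚ) - 1) * ∑ b ∈ Finset.range B, ((q : ℚ)⁻¹) ^ b < q := by
    have hg := mul_neg_geom_sum ((q : ℚ)⁻¹) B
    have hqq : (q : ℚ) - 1 = q * (1 - (q : ℚ)⁻¹) := by field_simp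
    rw [hqq, mul_assoc, hg]
    have : (0 : ℚ) < (q : ℚ)⁻¹ ^ B := by positivity
    nlinarith
  have h4 : (7 * q : ℚ) ≤ (q - 1) * t := by exact_mod_cast ht
  rw [h2, hsum] at h1
  nlinarith


/-! ### The prime 3 -/

/-- The cardinalities of the level sets of `q = 3` at `t = 3`, `t = 6` and `t = 9`. -/
def levelCounts : ℕ → ℕ × ℕ × ℕ
  | 0 => (0, 0, 0)
  | 1 => (0, 0, 0)
  -- The two ones are `{2, 4}` and `{1, 2}`, with digits 3 and 6.
  | 2 => (1, 1, 0)
  | m + 3 =>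
    let x := levelCounts m
    let y := levelCounts (m + 1)
    let z := levelCounts (m + 2)
    -- The empty digit leads from target 3 to target 9 at the same cardinality, so the new third
    -- entry reappears in the first.
    (z.1 + z.2.1 + (x.2.1 + y.2.2), y.1 + z.2.1 + y.2.2, x.2.1 + y.2.2)

lemma levelSets_three_eq_empty {t m : ℤ} (ht : 11 ≤ t) : levelSets 3 t m = ∅ :=
  levelSets_eq_empty_of_le le_rfl (by push_cast; omega)

lemma encard_levelSets_three_nine (m : ℤ) :
    (levelSets 3 9 m).encard
      = (levelSets 3 9 (m - 2)).encard + (levelSets 3 6 (m - 3)).encard := by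
  rw [encard_levelSets le_rfl (by decide)]
  simp [levelSets_three_eq_empty]

lemma encard_levelSets_three_six (m : ℤ) :
    (levelSets 3 6 m).encard
      = (levelSets 3 6 (m - 1)).encard + (levelSets 3 9 (m - 2)).encard
      + (levelSets 3 3 (m - 2)).encard + if m = 2 then 1 else 0 := by
  rw [encard_levelSets le_rfl (by decide)]
  simp [levelSets_three_eq_empty, levelSets_eq_empty_of_neg, encard_levelSets_zero, sub_eq_zero]

lemma encard_levelSets_three_three (m : ℤ) :
    (levelSets 3 3 m).encard
      = (levelSets 3 9 m).encard + (levelSets 3 6 (m - 1)).encard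
      + (levelSets 3 3 (m - 1)).encard + if m = 2 then 1 else 0 := by
  rw [encard_levelSets le_rfl (by decide)]
  simp [levelSets_eq_empty_of_neg, encard_levelSets_zero, sub_eq_zero]

lemma encard_levelSets_three_four (m : ℤ) :
    (levelSets 3 4 m).encard
      = (levelSets 3 9 (m - 1)).encard + (levelSets 3 6 (m - 1)).encard
      + (levelSets 3 3 (m - 2)).encard + if m = 1 then 1 else 0 := by
  rw [encard_levelSets le_rfl (by decide)]
  simp [levelSets_three_eq_empty, levelSets_eq_empty_of_neg, encard_levelSets_zero, sub_eq_zero]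
  ring

lemma encard_levelSets_eq_levelCounts (m : ℕ) :
    (levelSets 3 3 m).encard = (levelCounts m).1 ∧
    (levelSets 3 6 m).encard = (levelCounts m).2.1 ∧
    (levelSets 3 9 m).encard = (levelCounts m).2.2 := by
  induction m using Nat.strong_induction_on with
  | _ m ih =>
    match m, ih with
    | 0, _ =>
      have h9 : (levelSets 3 9 0).encard = 0 := by
        rw [encard_levelSets_three_nine]
        simp [levelSets_eq_empty_of_card_neg]
      have h6 : (levelSets 3 6 0).encard = 0 := by
        rw [encard_levelSets_three_six]
        simp [levelSets_eq_empty_of_card_neg]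
      rw [Nat.cast_zero, encard_levelSets_three_three, h9, h6]
      simp [levelSets_eq_empty_of_card_neg, levelCounts]
    | 1, ih =>
      obtain ⟨h3, h6, -⟩ := ih 0 (by norm_num)
      simp only [levelCounts, Nat.cast_zero] at h3 h6
      have h9' : (levelSets 3 9 1).encard = 0 := by
        rw [encard_levelSets_three_nine]
        simp [levelSets_eq_empty_of_card_neg]
      have h6' : (levelSets 3 6 1).encard = 0 := by
        rw [encard_levelSets_three_six, sub_self, h6]
        simp [levelSets_eq_empty_of_card_neg]
      rw [Nat.cast_one, encard_levelSets_three_three, h9', h6', sub_self, h3, h6]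
      simp [levelCounts]
    | 2, ih =>
      obtain ⟨h3, -, h9⟩ := ih 0 (by norm_num)
      obtain ⟨h3', h6', -⟩ := ih 1 (by norm_num)
      simp only [levelCounts, Nat.cast_zero, Nat.cast_one] at h3 h9 h3' h6'
      have e : (2 : ℤ) - 1 = 1 := by norm_num
      have h9'' : (levelSets 3 9 2).encard = 0 := by
        rw [encard_levelSets_three_nine, sub_self, h9]
        simp [levelSets_eq_empty_of_card_neg]
      have h6'' : (levelSets 3 6 2).encard = 1 := by
        rw [encard_levelSets_three_six, e, sub_self, h6', h9, h3]
        simp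
      rw [Nat.cast_ofNat, encard_levelSets_three_three, h9'', h6'', e, h6', h3']
      simp [levelCounts]
    | m + 3, ih =>
      obtain ⟨-, h6, -⟩ := ih m (by omega)
      obtain ⟨h3', h6', h9'⟩ := ih (m + 1) (by omega)
      obtain ⟨h3'', h6'', -⟩ := ih (m + 2) (by omega)
      have e1 : ((m + 3 : ℕ) : ℤ) - 1 = (m + 2 : ℕ) := by push_cast; ring
      have e2 : ((m + 3 : ℕ) : ℤ) - 2 = (m + 1 : ℕ) := by push_cast; ring
      have e3 : ((m + 3 : ℕ) : ℤ) - 3 = m := by push_cast; ring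
      have e4 : ¬ ((m + 3 : ℕ) : ℤ) = 2 := by push_cast; omega
      have h9 : (levelSets 3 9 ((m + 3 : ℕ) : ℤ)).encard = (levelCounts (m + 3)).2.2 := by
        rw [encard_levelSets_three_nine, e2, e3, h9', h6, levelCounts]
        push_cast
        ring
      refine ⟨?_, ?_, h9⟩
      · rw [encard_levelSets_three_three, h9, e1, h6'', h3'', if_neg e4]
        simp only [levelCounts]
        push_cast
        ring
      · rw [encard_levelSets_three_six, e1, e2, h6'', h9', h3', if_neg e4, levelCounts]
        push_cast
        ring

/-- The number of `n`-element solutions for `q = 3`, where `n ≥ 2`. -/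
def solutionCount (n : ℕ) : ℕ :=
  (levelCounts (n - 2)).1 + (levelCounts (n - 1)).2.1 + (levelCounts (n - 1)).2.2

lemma encard_solutions_three {n : ℕ} (hn : 2 ≤ n) :
    (levelSets 3 4 n).encard = solutionCount n := by
  obtain ⟨k, rfl⟩ := Nat.exists_eq_add_of_le' hn
  obtain ⟨h3, -, -⟩ := encard_levelSets_eq_levelCounts k
  obtain ⟨-, h6, h9⟩ := encard_levelSets_eq_levelCounts (k + 1)
  have e1 : ((k + 2 : ℕ) : ℤ) - 1 = (k + 1 : ℕ) := by push_cast; ring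
  have e2 : ((k + 2 : ℕ) : ℤ) - 2 = k := by push_cast; ring
  have e3 : ¬ ((k + 2 : ℕ) : ℤ) = 1 := by push_cast; omega
  rw [encard_levelSets_three_four, e1, e2, h3, h6, h9, if_neg e3, solutionCount]
  simp only [Nat.add_sub_cancel, show k + 2 - 1 = k + 1 by omega]
  push_cast
  ring

/-! ### The primes 5, 7 and beyond -/

lemma levelSets_five_eq_empty {t m : ℤ} (ht : 9 ≤ t) : levelSets 5 t m = ∅ :=
  levelSets_eq_empty_of_le (by norm_num) (by push_cast; omega)

lemma levelSets_seven_eq_empty {t m : ℤ} (ht : 9 ≤ t) : levelSets 7 t m = ∅ :=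
  levelSets_eq_empty_of_le (by norm_num) (by push_cast; omega)

/-- From target 5, digit 4 (`{1}`) returns to 5 and digit 5 (`{1, 4}`) stops. -/
lemma encard_levelSets_five_five (m : ℕ) :
    (levelSets 5 5 m).encard = if 2 ≤ m then 1 else 0 := by
  have step : ∀ m : ℤ, (levelSets 5 5 m).encard
      = (levelSets 5 5 (m - 1)).encard + if m = 2 then 1 else 0 := fun m => by
    rw [encard_levelSets (by norm_num) (by decide)]
    simp [levelSets_five_eq_empty, levelSets_eq_empty_of_neg, encard_levelSets_zero, sub_eq_zero]
  induction m with
  | zero =>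
    rw [step]
    simp [levelSets_eq_empty_of_card_neg]
  | succ m ih =>
    rw [step, show ((m + 1 : ℕ) : ℤ) - 1 = m by push_cast; ring, ih]
    rcases lt_trichotomy m 1 with h | rfl | h
    · rw [if_neg (by omega), if_neg (by omega), if_neg (by omega), add_zero]
    · simp
    · rw [if_pos (by omega), if_neg (by omega), if_pos (by omega), add_zero]

lemma encard_solutions_five {n : ℕ} (hn : 4 ≤ n) : (levelSets 5 4 n).encard = 1 := by
  rw [encard_levelSets (by norm_num) (by decide)]
  have h := encard_levelSets_five_five (n - 2)
  rw [if_pos (by omega), Nat.cast_sub (by omega), Nat.cast_ofNat] at h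
  have e : ¬ n = 1 := by omega
  simp [levelSets_five_eq_empty, levelSets_eq_empty_of_neg, encard_levelSets_zero, sub_eq_zero,
    h, e]

/-- From target 7, digit 6 (`{1, 2}`) returns to 7 and digit 7 stops. Each return uses two elements
and the stop three, whence the parity. -/
lemma encard_levelSets_seven_seven (m : ℕ) :
    (levelSets 7 7 m).encard = if 3 ≤ m ∧ Odd m then 1 else 0 := by
  have step : ∀ m : ℤ, (levelSets 7 7 m).encard
      = (levelSets 7 7 (m - 2)).encard + if m = 3 then 1 else 0 := fun m => by
    rw [encard_levelSets (by norm_num) (by decide)]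
    simp [levelSets_seven_eq_empty, encard_levelSets_zero, sub_eq_zero]
  induction m using Nat.twoStepInduction with
  | zero =>
    rw [step]
    simp [levelSets_eq_empty_of_card_neg]
  | one =>
    rw [step]
    simp [levelSets_eq_empty_of_card_neg]
  | more m ih _ =>
    rw [step, show ((m + 2 : ℕ) : ℤ) - 2 = m by push_cast; ring, ih]
    rcases lt_trichotomy m 1 with h | rfl | h
    · rw [if_neg (by omega), if_neg (by omega), if_neg (by omega), add_zero]
    · simp [show Odd 3 by decide]
    · have e : 3 ≤ m ∧ Odd m ↔ 3 ≤ m + 2 ∧ Odd (m + 2) := by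
        simp only [Nat.odd_iff]
        omega
      have e' : ¬ ((m + 2 : ℕ) : ℤ) = 3 := by omega
      simp only [e, if_neg e', add_zero]

lemma encard_solutions_seven {n : ℕ} (hn : 4 ≤ n) :
    (levelSets 7 4 n).encard = if Even n then 0 else 1 := by
  rw [encard_levelSets (by norm_num) (by decide)]
  have h := encard_levelSets_seven_seven (n - 2)
  have e : ¬ n = 1 := by omega
  have e' : 3 ≤ n - 2 ∧ Odd (n - 2) ↔ ¬ Even n := by
    simp only [Nat.odd_iff, Nat.even_iff]
    omega
  simp only [e', Nat.cast_sub (show 2 ≤ n by omega), Nat.cast_ofNat, ite_not] at h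
  simp [levelSets_seven_eq_empty, levelSets_eq_empty_of_neg, encard_levelSets_zero, sub_eq_zero,
    h, e]

lemma levelSets_four_eq_empty {q : ℕ} (hq : 11 ≤ q) (hodd : Odd q) {n : ℕ} (hn : 2 ≤ n) :
    levelSets q 4 n = ∅ := by
  have large : ∀ t m : ℤ, 1 ≤ t → levelSets q (q * t) m = ∅ := fun t m ht =>
    levelSets_eq_empty_of_le (by omega) (by
      have : (q : ℤ) * 1 ≤ q * t := mul_le_mul_of_nonneg_left ht (by positivity)
      have : (11 : ℤ) ≤ q := by exact_mod_cast hq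
      nlinarith)
  have small : ∀ t m : ℤ, t < 0 → levelSets q (q * t) m = ∅ := fun t m ht =>
    levelSets_eq_empty_of_neg (mul_neg_of_pos_of_neg (by omega) ht)
  have e : ¬ n = 1 := by omega
  have h0 : (levelSets q (q * (4 - 4)) ((n : ℤ) - 1)).encard = 0 := by
    simp [encard_levelSets_zero (show 3 ≤ q by omega), sub_eq_zero, e]
  rw [← Set.encard_eq_zero, encard_levelSets (by omega) hodd, h0, large 4 _ (by norm_num),
    large (4 - 1) _ (by norm_num), large (4 - 2) _ (by norm_num), large (4 - 3) _ (by norm_num),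
    small (4 - 5) _ (by norm_num), small (4 - 6) _ (by norm_num), small (4 - 7) _ (by norm_num)]
  simp

/-! ### Assembling the primes -/

/-- A set admissible for two primes lies in `{1, 2, 4}`, which is too small. -/
lemma disjoint_levelSets {p q : ℕ} (hp : p.Prime) (hq : q.Prime) (hpq : p ≠ q) (hp2 : Odd p)
    {t m : ℤ} (hm : 4 ≤ m) : Disjoint (levelSets p t m) (levelSets q t m) := by
  rw [Set.disjoint_left]
  rintro X ⟨hcard, -, hXp⟩ ⟨-, -, hXq⟩
  have hsub : X ⊆ {1, 2, 4} := by
    intro x hx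
    obtain ⟨α, β, hα, rfl⟩ := hXp x hx
    obtain ⟨γ, δ, -, h⟩ := hXq _ hx
    cases β with
    | zero => interval_cases α <;> simp
    | succ β =>
      have hdvd : p ∣ 2 ^ γ * q ^ δ := h ▸ ⟨2 ^ α * p ^ β, by ring⟩
      rcases hp.dvd_mul.1 hdvd with h | h
      · have := (Nat.prime_dvd_prime_iff_eq hp Nat.prime_two).1 (hp.dvd_of_dvd_pow h)
        subst this
        exact absurd hp2 (by decide)
      · exact absurd ((Nat.prime_dvd_prime_iff_eq hp hq).1 (hp.dvd_of_dvd_pow h)) hpq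
  have : X.card ≤ 3 := Finset.card_le_card hsub
  omega

lemma solutions_eq {n : ℕ} (hn : 2 ≤ n) :
    solutions n = levelSets 3 4 n ∪ levelSets 5 4 n ∪ levelSets 7 4 n := by
  have key : ∀ X : Finset ℕ, X ∈ solutions n ↔
      ∃ q : ℕ, q.Prime ∧ Odd q ∧ X ∈ levelSets q 4 n := by
    intro X
    have hsum : ∑ x ∈ X, (4 : ℚ) / (x : ℚ) = 4 * ∑ x ∈ X, (1 : ℚ) / (x : ℚ) := by
      rw [Finset.mul_sum]
      exact Finset.sum_congr rfl fun x _ => by ring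
    simp only [solutions, levelSets, Set.mem_ofPred_eq, hsum, Nat.cast_inj, Int.cast_ofNat]
    constructor
    · rintro ⟨h1, h2, q, hq, hodd, h3⟩
      exact ⟨q, hq, hodd, h1, by rw [h2, mul_one], h3⟩
    · rintro ⟨q, hq, hodd, h1, h2, h3⟩
      exact ⟨h1, by linarith, q, hq, hodd, h3⟩
  ext X
  rw [key]
  constructor
  · rintro ⟨q, hq, hodd, hX⟩
    rcases lt_or_ge q 11 with h | h
    · obtain rfl | rfl | rfl : q = 3 ∨ q = 5 ∨ q = 7 := by
        clear hX
        interval_cases q <;> first | omega | (revert hodd; decide) | (revert hq; norm_num)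
      · exact Or.inl (Or.inl hX)
      · exact Or.inl (Or.inr hX)
      · exact Or.inr hX
    · rw [levelSets_four_eq_empty h hodd hn] at hX
      exact hX.elim
  · rintro ((h | h) | h)
    · exact ⟨3, by norm_num, by decide, h⟩
    · exact ⟨5, by norm_num, by decide, h⟩
    · exact ⟨7, by norm_num, by decide, h⟩

lemma encard_solutions {n : ℕ} (hn : 4 ≤ n) :
    (solutions n).encard = (solutionCount n + correction n : ℕ) := by
  have hm : (4 : ℤ) ≤ n := by exact_mod_cast hn
  rw [solutions_eq (by omega), Set.encard_union_eq, Set.encard_union_eq,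
    encard_solutions_three (by omega), encard_solutions_five hn, encard_solutions_seven hn,
    correction]
  · split_ifs
    · simp
    · push_cast
      rw [add_assoc, one_add_one_eq_two]
  · exact disjoint_levelSets (by norm_num) (by norm_num) (by norm_num) (by decide) hm
  · rw [Set.disjoint_union_left]
    exact ⟨disjoint_levelSets (by norm_num) (by norm_num) (by norm_num) (by decide) hm,
      disjoint_levelSets (by norm_num) (by norm_num) (by norm_num) (by decide) hm⟩

lemma finite_solutions {n : ℕ} (hn : 4 ≤ n) : (solutions n).Finite :=
  Set.finite_of_encard_eq_coe (encard_solutions hn)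

lemma numSolutions_eq {n : ℕ} (hn : 4 ≤ n) :
    numSolutions n = solutionCount n + correction n := by
  rw [numSolutions, Set.ncard, encard_solutions hn, ENat.toNat_natCast]

/-! ### Growth rates -/

lemma levelCounts_add_three (m : ℕ) :
    (levelCounts (m + 3)).1 = (levelCounts (m + 2)).1 + (levelCounts (m + 2)).2.1
      + (levelCounts (m + 3)).2.2 ∧
    (levelCounts (m + 3)).2.1 = (levelCounts (m + 1)).1 + (levelCounts (m + 2)).2.1
      + (levelCounts (m + 1)).2.2 ∧
    (levelCounts (m + 3)).2.2 = (levelCounts m).2.1 + (levelCounts (m + 1)).2.2 := by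
  simp [levelCounts]

lemma solutionCount_succ_le {n : ℕ} (hn : 5 ≤ n) :
    solutionCount (n + 1) ≤ 3 * solutionCount n := by
  obtain ⟨k, rfl⟩ := Nat.exists_eq_add_of_le' hn
  have h0 := levelCounts_add_three k
  have h1 := levelCounts_add_three (k + 1)
  have h2 := levelCounts_add_three (k + 2)
  -- This and `h4` are the inequalities added to the recurrences to make the claim linear
  -- arithmetic. Small indices are computed, as the recurrence starts at 3.
  have h3 : (levelCounts (k + 1)).2.2 ≤ (levelCounts (k + 1)).1 := by
    match k with
    | 0 => decide
    | 1 => decide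
    | k + 2 =>
      have := levelCounts_add_three k
      simp only [add_assoc, Nat.reduceAdd] at this ⊢
      omega
  have h4 : (levelCounts k).2.1 ≤ (levelCounts (k + 1)).2.1 := by
    match k with
    | 0 => decide
    | 1 => decide
    | k + 2 =>
      have := levelCounts_add_three k
      simp only [add_assoc, Nat.reduceAdd] at this ⊢
      omega
  simp only [solutionCount, add_assoc, Nat.reduceAdd,
    show k + 6 - 2 = k + 4 by omega, show k + 6 - 1 = k + 5 by omega,
    show k + 5 - 2 = k + 3 by omega, show k + 5 - 1 = k + 4 by omega] at h0 h1 h2 ⊢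
  omega

lemma five_mul_solutionCount_le {n : ℕ} (hn : 2 ≤ n) :
    5 * solutionCount n ≤ solutionCount (n + 5) := by
  obtain ⟨k, rfl⟩ := Nat.exists_eq_add_of_le' hn
  have h4 : (levelCounts k).1 + (levelCounts k).2.1 + (levelCounts (k + 1)).2.2
      ≤ (levelCounts (k + 1)).1 := by
    match k with
    | 0 => decide
    | 1 => decide
    | k + 2 =>
      have := levelCounts_add_three k
      simp only [add_assoc, Nat.reduceAdd] at this ⊢
      omega
  have h5 : (levelCounts (k + 1)).2.1 + (levelCounts k).1 + (levelCounts k).2.2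
      ≤ (levelCounts (k + 2)).2.1 := by
    match k with
    | 0 => decide
    | k + 1 =>
      have := levelCounts_add_three k
      simp only [add_assoc, Nat.reduceAdd] at this ⊢
      omega
  have h0 := levelCounts_add_three k
  have h1 := levelCounts_add_three (k + 1)
  have h2 := levelCounts_add_three (k + 2)
  have h3 := levelCounts_add_three (k + 3)
  simp only [solutionCount, add_assoc, Nat.reduceAdd, Nat.add_sub_cancel,
    show k + 7 - 2 = k + 5 by omega, show k + 7 - 1 = k + 6 by omega,
    show k + 2 - 1 = k + 1 by omega] at h0 h1 h2 h3 ⊢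
  omega

lemma counts_add_two (i d : ℕ) :
    (counts i (d + 2)).1 =
      (counts i (d + 1)).1 + 3 * (counts i (d + 1)).2.1 + (counts i (d + 1)).2.2 ∧
    (counts i (d + 2)).2.1 =
      (counts i (d + 1)).1 + 2 * (counts i (d + 1)).2.1 + (counts i (d + 1)).2.2 ∧
    (counts i (d + 2)).2.2 = (counts i (d + 1)).2.1 + (counts i (d + 1)).2.2 := by
  simp [counts]

/-- In terms of the triple at depth `d`, `N i (d + 1)` has coefficients 7, 18, 9 against 2, 5, 2 for
`N i d`. Depth 0 is excluded because its value 0 is a convention. -/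
lemma N_succ_le (i : ℕ) {d : ℕ} (hd : 1 ≤ d) : N i (d + 1) ≤ 5 * N i d := by
  obtain ⟨d, rfl⟩ := Nat.exists_eq_add_of_le' hd
  have := counts_add_two i d
  simp only [N, add_assoc, Nat.reduceAdd] at this ⊢
  omega

lemma le_N_succ (i : ℕ) {d : ℕ} (hd : 1 ≤ d) : 3 * N i d ≤ N i (d + 1) := by
  obtain ⟨d, rfl⟩ := Nat.exists_eq_add_of_le' hd
  have := counts_add_two i d
  simp only [N, add_assoc, Nat.reduceAdd] at this ⊢
  omega

lemma solutionCount_le (k : ℕ) : solutionCount (k + 9) ≤ N 1 (k + 6) + N 2 (k + 6) := by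
  induction k with
  | zero => decide
  | succ k ih =>
    have h := solutionCount_succ_le (show 5 ≤ k + 9 by omega)
    have h1 := le_N_succ 1 (show 1 ≤ k + 6 by omega)
    have h2 := le_N_succ 2 (show 1 ≤ k + 6 by omega)
    rw [show k + 1 + 9 = k + 9 + 1 by ring, show k + 1 + 6 = k + 6 + 1 by ring]
    omega

lemma N_add_N_le_solutionCount {a b n : ℕ} (ha : 1 ≤ a) (hb : 1 ≤ b) (hn : 2 ≤ n)
    (h : N 1 a + N 2 b ≤ solutionCount n) (k : ℕ) :
    N 1 (a + k) + N 2 (b + k) ≤ solutionCount (n + 5 * k) := by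
  induction k with
  | zero => exact h
  | succ k ih =>
    have h0 := five_mul_solutionCount_le (show 2 ≤ n + 5 * k by omega)
    have h1 := N_succ_le 1 (show 1 ≤ a + k by omega)
    have h2 := N_succ_le 2 (show 1 ≤ b + k by omega)
    rw [show n + 5 * (k + 1) = n + 5 * k + 5 by ring, ← add_assoc, ← add_assoc]
    omega

end UnitFractions

theorem proposition3 (n : ℕ) (hn : 9 ≤ n) :
    (UnitFractions.solutions n).Finite ∧
    (UnitFractions.numSolutions n : ℤ) - UnitFractions.correction n
      ≤ UnitFractions.N 1 (n - 3) + UnitFractions.N 2 (n - 3) ∧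
    (n % 5 = 0 →
      (UnitFractions.N 1 (n / 5) + UnitFractions.N 2 (n / 5) : ℤ)
        ≤ (UnitFractions.numSolutions n : ℤ) - UnitFractions.correction n) ∧
    (n % 5 = 1 →
      (UnitFractions.N 1 ((n + 4) / 5) + UnitFractions.N 2 ((n - 1) / 5) : ℤ)
        ≤ (UnitFractions.numSolutions n : ℤ) - UnitFractions.correction n) ∧
    (n % 5 = 2 →
      (UnitFractions.N 1 ((n + 3) / 5) + UnitFractions.N 2 ((n + 3) / 5) : ℤ)
        ≤ (UnitFractions.numSolutions n : ℤ) - UnitFractions.correction n) ∧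
    (n % 5 = 3 →
      (UnitFractions.N 1 ((n + 2) / 5) + UnitFractions.N 2 ((n - 3) / 5) : ℤ)
        ≤ (UnitFractions.numSolutions n : ℤ) - UnitFractions.correction n) ∧
    (n % 5 = 4 →
      (UnitFractions.N 1 ((n + 6) / 5) + UnitFractions.N 2 ((n + 1) / 5) : ℤ)
        ≤ (UnitFractions.numSolutions n : ℤ) - UnitFractions.correction n) := by
  obtain ⟨k, rfl⟩ := Nat.exists_eq_add_of_le' hn
  rw [UnitFractions.numSolutions_eq (by omega), Nat.cast_add, add_sub_cancel_right]
  -- Each residue class modulo 5 starts from its least member among 9, …, 13, where the inequality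
  -- is computed; raising `n` by 5 raises both depths by 1.
  refine ⟨UnitFractions.finite_solutions (by omega),
    by exact_mod_cast UnitFractions.solutionCount_le k, fun h => ?_, fun h => ?_, fun h => ?_,
    fun h => ?_, fun h => ?_⟩
  · obtain ⟨j, rfl⟩ : ∃ j, k = 5 * j + 1 := ⟨k / 5, by omega⟩
    have := UnitFractions.N_add_N_le_solutionCount (a := 2) (b := 2) (n := 10)
      (by norm_num) (by norm_num) (by norm_num) (by decide) j
    rw [show (5 * j + 1 + 9) / 5 = 2 + j by omega, show 5 * j + 1 + 9 = 10 + 5 * j by ring]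
    exact_mod_cast this
  · obtain ⟨j, rfl⟩ : ∃ j, k = 5 * j + 2 := ⟨k / 5, by omega⟩
    have := UnitFractions.N_add_N_le_solutionCount (a := 3) (b := 2) (n := 11)
      (by norm_num) (by norm_num) (by norm_num) (by decide) j
    rw [show (5 * j + 2 + 9 + 4) / 5 = 3 + j by omega,
      show (5 * j + 2 + 9 - 1) / 5 = 2 + j by omega, show 5 * j + 2 + 9 = 11 + 5 * j by ring]
    exact_mod_cast this
  · obtain ⟨j, rfl⟩ : ∃ j, k = 5 * j + 3 := ⟨k / 5, by omega⟩
    have := UnitFractions.N_add_N_le_solutionCount (a := 3) (b := 3) (n := 12)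
      (by norm_num) (by norm_num) (by norm_num) (by decide) j
    rw [show (5 * j + 3 + 9 + 3) / 5 = 3 + j by omega, show 5 * j + 3 + 9 = 12 + 5 * j by ring]
    exact_mod_cast this
  · obtain ⟨j, rfl⟩ : ∃ j, k = 5 * j + 4 := ⟨k / 5, by omega⟩
    have := UnitFractions.N_add_N_le_solutionCount (a := 3) (b := 2) (n := 13)
      (by norm_num) (by norm_num) (by norm_num) (by decide) j
    rw [show (5 * j + 4 + 9 + 2) / 5 = 3 + j by omega,
      show (5 * j + 4 + 9 - 3) / 5 = 2 + j by omega, show 5 * j + 4 + 9 = 13 + 5 * j by ring]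
    exact_mod_cast this
  · obtain ⟨j, rfl⟩ : ∃ j, k = 5 * j := ⟨k / 5, by omega⟩
    have := UnitFractions.N_add_N_le_solutionCount (a := 3) (b := 2) (n := 9)
      (by norm_num) (by norm_num) (by norm_num) (by decide) j
    rw [show (5 * j + 9 + 6) / 5 = 3 + j by omega,
      show (5 * j + 9 + 1) / 5 = 2 + j by omega, show 5 * j + 9 = 9 + 5 * j by ring]
    exact_mod_cast this
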